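/- For $N\ge 0$ let $P_N^{(1,1)}$ be the Jacobi polynomial of degree $N$ with parameters $\alpha=\beta=1$, where $$P_N^{(\alpha,\beta)}(x)=\sum_{k=0}^{N}\binom{N+\alpha}{N-k}\binom{N+\beta}{k}\Big(\frac{x-1}{2}\Big)^{k}\Big(\frac{x+1}{2}\Big)^{N-k}.$$ (i) For every $N$ the set of all (complex) zeros of $P_N^{(1,1)}$ consists of $N$ distinct real numbers $1>x_0^{(N)}>x_1^{(N)}>\dots>x_{N-1}^{(N)}>-1$, and as $N\to\infty$ they converge to the Chebyshev nodes, uniformly in the index: $$\max_{0\le n\le N-1}\Big|x_n^{(N)}-\cos\Big(\frac{(2n+1)\pi}{2N}\Big)\Big|\longrightarrow 0 .$$ (ii) For $M\ge 2$ and real $a<b$, call $a=s_1<s_2<\dots<s_M=b$ an equilibrium placement of $M$ antennas on $[a,b]$ if $\sum_{i\ne m}\frac{1}{s_m-s_i}=0$ for every $1<m<M$. There is exactly one, namely $s_m=\frac{b-a}{2}t_m+\frac{a+b}{2}$ with $t_1=-1$, $t_M=1$ and $t_m=x^{(M-2)}_{M-1-m}$ for $1<m<M$. (iii) Let the closed-form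 placement be $\tau^{(M)}_1=-1$, $\tau^{(M)}_M=1$ and $\tau^{(M)}_m=\cos\big(\frac{(2(M-1-m)+1)\pi}{2(M-2)}\big)$ for $1<m<M$. For all real sequences $a_M<b_M$, the equilibrium placements $s^{(M)}$ of $M$ antennas on $[a_M,b_M]$ satisfy $$\frac{1}{b_M-a_M}\max_{1\le m\le M}\Big|s^{(M)}_m-\Big(\frac{b_M-a_M}{2}\tau^{(M)}_m+\frac{a_M+b_M}{2}\Big)\Big|\longrightarrow 0\qquad(M\to\infty).$$ Both the normalized equilibrium positions $t_m^{(M)}=\frac{2s_m^{(M)}-(a_M+b_M)}{b_M-a_M}$ and the closed-form positions $\tau_m^{(M)}$ asymptotically follow the arcsine distribution: the empirical measures $\frac1M\sum_{m=1}^M\delta_{t^{(M)}_m}$ and $\frac1M\sum_{m=1}^M\delta_{\tau^{(M)}_m}$ converge weakly, as $M\to\infty$, to the probability measure on $(-1,1)$ with density $\frac{1}{\pi\sqrt{1-u^2}}$. -/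

import Mathlib

open Filter Topology MeasureTheory
open scoped Polynomial BoundedContinuousFunction

/-- The Jacobi polynomial
`P_N^{(α,β)}(x) = ∑_{k=0}^N binom(N+α, N-k) binom(N+β, k) ((x-1)/2)^k ((x+1)/2)^(N-k)`
(generalized binomial coefficients). -/
noncomputable def jacobiP (α β : ℝ) (N : ℕ) : ℝ[X] :=
  ∑ k ∈ Finset.range (N + 1),
    Polynomial.C (Ring.choose ((N : ℝ) + α) (N - k) * Ring.choose ((N : ℝ) + β) k) *
      (Polynomial.C (1 / 2) * (Polynomial.X - 1)) ^ k *
      (Polynomial.C (1 / 2) * (Polynomial.X + 1)) ^ (N - k)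

/-- The Chebyshev nodes `cos ((2n+1)π/(2N))`, decreasing in `n = 0, …, N-1`. -/
noncomputable def chebyshevNode (N n : ℕ) : ℝ :=
  Real.cos ((2 * (n : ℝ) + 1) * Real.pi / (2 * (N : ℝ)))

/-- `M` antennas in the normalized angular domain `[-1,1]`, in increasing order: the first and the
last one are fixed at `-1` and `1`, and the `M-2` others occupy the points
`y 0 > y 1 > ⋯ > y (M-3)`, listed from the smallest to the largest.
(The index `m : Fin M` starts from `0`.) -/
noncomputable def placement (M : ℕ) (y : ℕ → ℝ) (m : Fin M) : ℝ :=
  if (m : ℕ) = 0 then -1 else if (m : ℕ) + 1 = M then 1 else y (M - 2 - m)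

/-- The closed-form placement of `M` antennas in the normalized angular domain. -/
noncomputable def closedFormPlacement (M : ℕ) : Fin M → ℝ :=
  placement M (chebyshevNode (M - 2))

/-- The increasing affine bijection from `[-1,1]` onto `[a,b]`. -/
noncomputable def toAngular (a b t : ℝ) : ℝ := (b - a) / 2 * t + (b + a) / 2

/-- The normalization from `[a,b]` onto `[-1,1]`. -/
noncomputable def toNormalized (a b s : ℝ) : ℝ := (2 * s - (a + b)) / (b - a)

/-- `s` is an equilibrium placement of `M` antennas on `[a,b]`: the antennas are ordered, the two
extreme ones are fixed at `a` and `b`, and at each other antenna the mutual repulsive forces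
(of all the other antennas, the two fixed ones included) balance. -/
def IsEquilibriumPlacement {M : ℕ} (a b : ℝ) (s : Fin M → ℝ) : Prop :=
  StrictMono s ∧
  (∀ m : Fin M, (m : ℕ) = 0 → s m = a) ∧
  (∀ m : Fin M, (m : ℕ) + 1 = M → s m = b) ∧
  ∀ m : Fin M, 0 < (m : ℕ) → (m : ℕ) + 1 < M →
    ∑ i ∈ Finset.univ.erase m, 1 / (s m - s i) = 0

/-- The arcsine distribution on `(-1,1)`, with density `1 / (π √(1 - u²))`. -/
noncomputable def arcsineMeasure : Measure ℝ :=
  volume.withDensity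
    ((Set.Ioo (-1 : ℝ) 1).indicator fun u => ENNReal.ofReal (1 / (Real.pi * √(1 - u ^ 2))))

/-- The empirical distributions `(1/M) ∑_m δ_{t_m}` of a family of configurations of `M` points
converge weakly to `μ` as `M → ∞`. -/
def EmpiricalTendsto (t : (M : ℕ) → Fin M → ℝ) (μ : Measure ℝ) : Prop :=
  ∀ f : ℝ →ᵇ ℝ,
    Tendsto (fun M : ℕ => (∑ m : Fin M, f (t M m)) / (M : ℝ)) atTop (𝓝 (∫ u, f u ∂μ))

open Polynomial in
/-- Rodrigues' formula for `P_N^{(1,1)}`. -/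
theorem iterate_derivative_X_sq_sub_one_pow (N : ℕ) :
    derivative^[N] ((X ^ 2 - 1 : ℝ[X]) ^ (N + 1)) =
      C ((2 : ℝ) ^ N * (N.factorial : ℝ)) * ((X ^ 2 - 1) * jacobiP 1 1 N) := by
  have hfac : (X ^ 2 - 1 : ℝ[X]) ^ (N + 1) = (X - C 1) ^ (N + 1) * (X + C 1) ^ (N + 1) := by
    rw [← mul_pow]; congr 1; simp only [map_one]; ring
  rw [hfac, iterate_derivative_mul, jacobiP, Finset.mul_sum, Finset.mul_sum]
  refine Finset.sum_congr rfl fun k hk => ?_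
  obtain ⟨j, rfl⟩ := Nat.exists_eq_add_of_le (Finset.mem_range_succ_iff.1 hk)
  have h1 : ((k + j : ℕ) : ℝ) + 1 = ((k + j + 1 : ℕ) : ℝ) := by push_cast; ring
  have hjk : k + j - k = j := by omega
  rw [iterate_derivative_X_sub_pow, iterate_derivative_X_add_pow, h1, Ring.choose_natCast,
    Ring.choose_natCast, hjk, Nat.descFactorial_eq_factorial_mul_choose,
    Nat.descFactorial_eq_factorial_mul_choose, show k + j + 1 - j = k + 1 by omega,
    show k + j + 1 - k = j + 1 by omega]
  have h2 : ((k + j).choose k : ℝ) * (k.factorial : ℝ) * (j.factorial : ℝ)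
      = ((k + j).factorial : ℝ) := by
    have := Nat.choose_mul_factorial_mul_factorial (Nat.le_add_right k j)
    rw [hjk] at this
    exact_mod_cast this
  have h3 : (2 : ℝ[X]) ^ (k + j) * (C (1 / 2) ^ k * C (1 / 2) ^ j) = 1 := by
    rw [← pow_add, ← mul_pow]
    have : (2 : ℝ[X]) * C (1 / 2) = 1 := by
      rw [← map_ofNat C 2, ← C_mul]; norm_num
    rw [this, one_pow]
  rw [← h2]
  simp only [nsmul_eq_mul, map_mul, map_pow, map_natCast, map_one, mul_pow, Nat.cast_mul]
  have h4 : (C (2 : ℝ) : ℝ[X]) = 2 := map_ofNat C 2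
  rw [h4]
  set A : ℝ[X] := C (1 / 2) ^ k
  set B : ℝ[X] := C (1 / 2) ^ j
  linear_combination (-(((k + j).choose k : ℝ[X]) * (k.factorial) * (j.factorial) *
    ((k + j + 1).choose j) * ((k + j + 1).choose k) * (X - 1) ^ (k + 1) * (X + 1) ^ (j + 1))) * h3

open Polynomial in
theorem natDegree_iterate_derivative {p : ℝ[X]} (k : ℕ) :
    (derivative^[k] p).natDegree = p.natDegree - k := by
  induction k with
  | zero => simp
  | succ k ih => rw [Function.iterate_succ_apply', natDegree_derivative, ih]; omega

open Polynomial in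
theorem natDegree_X_sq_sub_one : (X ^ 2 - 1 : ℝ[X]).natDegree = 2 := by
  simpa using natDegree_X_pow_sub_C (n := 2) (r := (1 : ℝ))

open Polynomial in
theorem X_sq_sub_one_ne_zero : (X ^ 2 - 1 : ℝ[X]) ≠ 0 :=
  ne_zero_of_natDegree_gt (n := 0) (by rw [natDegree_X_sq_sub_one]; norm_num)

open Polynomial in
theorem eval_jacobiP_ne_zero_of_one_le_abs (N : ℕ) {x : ℝ} (hx : 1 ≤ |x|) :
    (jacobiP 1 1 N).eval x ≠ 0 := by
  have hN : (N : ℝ) + 1 = ((N + 1 : ℕ) : ℝ) := by push_cast; ring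
  -- up to the sign `ε ^ N`, all the terms of the sum are nonnegative
  obtain ⟨ε, h1, h2, h3⟩ : ∃ ε : ℝ,
      0 ≤ ε * (1 / 2 * (x - 1)) ∧ 0 ≤ ε * (1 / 2 * (x + 1)) ∧
        (0 < ε * (1 / 2 * (x - 1)) ∨ 0 < ε * (1 / 2 * (x + 1))) := by
    rcases le_abs.1 hx with h | h
    · exact ⟨1, by linarith, by linarith, Or.inr (by linarith)⟩
    · exact ⟨-1, by linarith, by linarith, Or.inl (by linarith)⟩
  set c := ε * (1 / 2 * (x - 1)) with hc
  set d := ε * (1 / 2 * (x + 1)) with hd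
  have key : ε ^ N * (jacobiP 1 1 N).eval x = ∑ k ∈ Finset.range (N + 1),
      ((N + 1).choose (N - k) : ℝ) * ((N + 1).choose k : ℝ) * c ^ k * d ^ (N - k) := by
    rw [jacobiP, eval_finsetSum, Finset.mul_sum]
    refine Finset.sum_congr rfl fun k hk => ?_
    obtain ⟨j, rfl⟩ := Nat.exists_eq_add_of_le (Finset.mem_range_succ_iff.1 hk)
    have hjk : k + j - k = j := by omega
    rw [hN, Ring.choose_natCast, Ring.choose_natCast, hjk, hc, hd, mul_pow ε, mul_pow ε, pow_add]
    simp only [eval_mul, eval_C, eval_pow, eval_sub, eval_add, eval_X, eval_one]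
    ring
  have hpos : 0 < ε ^ N * (jacobiP 1 1 N).eval x := by
    rw [key]
    refine Finset.sum_pos' (fun k _ => by positivity) ?_
    rcases h3 with h3 | h3
    · exact ⟨N, by simp, by simpa using by positivity⟩
    · exact ⟨0, by simp, by simpa using by positivity⟩
  exact right_ne_zero_of_mul hpos.ne'

open Polynomial in
theorem jacobiP_ne_zero (N : ℕ) : jacobiP 1 1 N ≠ 0 := fun h =>
  eval_jacobiP_ne_zero_of_one_le_abs N (x := 1) (by simp) (by simp [h])

open Polynomial in
theorem natDegree_jacobiP (N : ℕ) : (jacobiP 1 1 N).natDegree = N := by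
  have h := congrArg natDegree (iterate_derivative_X_sq_sub_one_pow N)
  rw [natDegree_iterate_derivative, natDegree_pow, natDegree_X_sq_sub_one,
    natDegree_C_mul (by positivity), natDegree_mul X_sq_sub_one_ne_zero (jacobiP_ne_zero N),
    natDegree_X_sq_sub_one] at h
  omega

/-- `(X² - 1) P_N^{(1,1)}` solves `(x² - 1) u'' = (N + 1) (N + 2) u`. -/
theorem X_sq_sub_one_mul_derivative_derivative (N : ℕ) :
    (Polynomial.X ^ 2 - 1 : ℝ[X]) *
        (Polynomial.derivative (Polynomial.derivative
          ((Polynomial.X ^ 2 - 1) * jacobiP 1 1 N))) =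
      Polynomial.C (((N : ℝ) + 1) * ((N : ℝ) + 2)) *
        ((Polynomial.X ^ 2 - 1) * jacobiP 1 1 N) := by
  open Polynomial in
  set u : ℝ[X] := (X ^ 2 - 1) * jacobiP 1 1 N with hu
  set p : ℝ[X] := (X ^ 2 - 1) ^ (N + 1) with hp
  have hR : derivative^[N] p = C ((2 : ℝ) ^ N * (N.factorial : ℝ)) * u :=
    iterate_derivative_X_sq_sub_one_pow N
  have h0 : derivative p * X * X - derivative p = C (2 * ((N : ℝ) + 1)) * (p * X) := by
    rw [hp, derivative_pow]
    simp only [Nat.add_sub_cancel, derivative_sub, derivative_one, derivative_X_pow, map_mul,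
      map_add, map_natCast, map_one, Nat.cast_add, Nat.cast_one, Nat.cast_ofNat]
    have : (C (2 : ℝ) : ℝ[X]) = 2 := map_ofNat C 2
    rw [this]; ring
  have h1 := congrArg (derivative^[N + 1]) h0
  simp only [iterate_derivative_sub, iterate_derivative_C_mul, iterate_derivative_mul_X,
    ← Function.iterate_succ_apply, Nat.add_sub_cancel] at h1
  simp only [Function.iterate_succ_apply', hR, derivative_C_mul] at h1
  have h2 : (N : ℝ[X]) * derivative (derivative^[N - 1] p) =
      N * (C ((2 : ℝ) ^ N * (N.factorial : ℝ)) * u) := by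
    rcases N with _ | N
    · simp
    · rw [← hR, Function.iterate_succ_apply', Nat.add_sub_cancel]
  have hc : (C ((2 : ℝ) ^ N * (N.factorial : ℝ)) : ℝ[X]) ≠ 0 :=
    C_ne_zero.2 (by positivity)
  apply mul_left_cancel₀ hc
  simp only [nsmul_eq_mul, map_mul, map_add, map_natCast, map_one, Nat.cast_add, Nat.cast_one] at h1 h2 ⊢
  have : (C (2 : ℝ) : ℝ[X]) = 2 := map_ofNat C 2
  rw [this] at h1 ⊢
  linear_combination h1 - ((N : ℝ[X]) + 1) * h2

open Polynomial in
theorem derivative_splits {p : ℝ[X]} (hp : p.Splits) : (derivative p).Splits := by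
  rw [splits_iff_card_roots] at hp ⊢
  have h1 := card_roots_le_derivative p
  have h2 := card_roots' (derivative p)
  have h3 := natDegree_derivative_le p
  omega

open Polynomial in
theorem iterate_derivative_splits {p : ℝ[X]} (hp : p.Splits) (k : ℕ) :
    (derivative^[k] p).Splits := by
  induction k with
  | zero => exact hp
  | succ k ih => rw [Function.iterate_succ_apply']; exact derivative_splits ih

open Polynomial in
theorem jacobiP_splits (N : ℕ) : (jacobiP 1 1 N).Splits := by
  have h1 : ((X ^ 2 - 1 : ℝ[X]) ^ (N + 1)).Splits := by
    have : (X ^ 2 - 1 : ℝ[X]) = (X - C 1) * (X + C 1) := by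
      simp only [map_one]; ring
    rw [this]
    exact ((Splits.X_sub_C _).mul (Splits.X_add_C _)).pow _
  have h2 := iterate_derivative_splits h1 N
  rw [iterate_derivative_X_sq_sub_one_pow] at h2
  have hc : (C ((2 : ℝ) ^ N * (N.factorial : ℝ)) : ℝ[X]) ≠ 0 :=
    C_ne_zero.2 (by positivity)
  exact h2.of_dvd
    (mul_ne_zero hc (mul_ne_zero X_sq_sub_one_ne_zero (jacobiP_ne_zero N)))
    ((dvd_mul_left _ _).mul_left _)

open Polynomial in
theorem abs_lt_one_of_isRoot_jacobiP {N : ℕ} {x : ℝ} (hx : (jacobiP 1 1 N).IsRoot x) : |x| < 1 := by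
  by_contra! h
  exact eval_jacobiP_ne_zero_of_one_le_abs N h hx

open Polynomial in
theorem jacobiP_roots_nodup (N : ℕ) : (jacobiP 1 1 N).roots.Nodup := by
  classical
  refine Multiset.nodup_iff_count_le_one.2 fun a => ?_
  rw [count_roots]
  by_contra! h
  have ha := ((one_lt_rootMultiplicity_iff_isRoot (jacobiP_ne_zero N)).1 h).1
  have hsq : (X ^ 2 - 1 : ℝ[X]).rootMultiplicity a = 0 := by
    refine rootMultiplicity_eq_zero fun h0 => ?_
    have h1 := (sq_lt_one_iff_abs_lt_one a).2 (abs_lt_one_of_isRoot_jacobiP ha)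
    simp only [IsRoot.def, eval_sub, eval_pow, eval_X, eval_one] at h0
    linarith
  have hu := mul_ne_zero X_sq_sub_one_ne_zero (jacobiP_ne_zero N)
  have hc : (C (((N : ℝ) + 1) * ((N : ℝ) + 2)) : ℝ[X]) ≠ 0 := C_ne_zero.2 (by positivity)
  have hode := X_sq_sub_one_mul_derivative_derivative N
  have hcu := mul_ne_zero hc hu
  have hm : ((X ^ 2 - 1) * jacobiP 1 1 N).rootMultiplicity a =
      (jacobiP 1 1 N).rootMultiplicity a := by
    rw [rootMultiplicity_mul hu, hsq, zero_add]
  have h1 := congrArg (rootMultiplicity a) hode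
  rw [rootMultiplicity_mul (hode ▸ hcu), rootMultiplicity_mul hcu, hsq, rootMultiplicity_C] at h1
  have hr1 : ((X ^ 2 - 1) * jacobiP 1 1 N).IsRoot a := ha.dvd (dvd_mul_left _ _)
  have hr2 : (derivative ((X ^ 2 - 1) * jacobiP 1 1 N)).IsRoot a :=
    ((one_lt_rootMultiplicity_iff_isRoot hu).1 (hm ▸ h)).2
  rw [derivative_rootMultiplicity_of_root hr2, derivative_rootMultiplicity_of_root hr1, hm] at h1
  omega

open Polynomial in
theorem eval_derivative_derivative_prod {M : ℕ} {s : Fin M → ℝ} (hs : Function.Injective s)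
    (m : Fin M) :
    (derivative (derivative (∏ i, (X - C (s i))))).eval (s m) =
      2 * (∏ i ∈ Finset.univ.erase m, (s m - s i)) *
        ∑ i ∈ Finset.univ.erase m, 1 / (s m - s i) := by
  rw [← Finset.mul_prod_erase _ _ (Finset.mem_univ m)]
  simp only [derivative_mul, derivative_add, derivative_sub, derivative_X, derivative_C, sub_zero,
    zero_mul, one_mul, eval_add, eval_mul, eval_sub, eval_X, eval_C,
    sub_self, add_zero]
  rw [derivative_prod_finset, eval_finsetSum, ← two_mul, mul_assoc]
  congr 1
  rw [Finset.mul_sum]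
  refine Finset.sum_congr rfl fun i hi => ?_
  have hne : s m - s i ≠ 0 := sub_ne_zero.2 fun h => (Finset.mem_erase.1 hi).1 (hs h).symm
  rw [← Finset.mul_prod_erase _ (fun i => s m - s i) hi, eval_mul, eval_prod]
  simp [field]

theorem exists_eq_prod_jacobiP (N : ℕ) : ∃ x : ℕ → ℝ,
    (∀ n n' : ℕ, n < n' → n' < N → x n' < x n) ∧
    (∀ n : ℕ, n < N → x n ∈ Set.Ioo (-1 : ℝ) 1) ∧
    jacobiP 1 1 N = Polynomial.C (jacobiP 1 1 N).leadingCoeff *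
      ∏ n ∈ Finset.range N, (Polynomial.X - Polynomial.C (x n)) := by
  open Polynomial in
  classical
  set S := (jacobiP 1 1 N).roots.toFinset with hS
  have hval : S.val = (jacobiP 1 1 N).roots := by
    rw [hS, Multiset.toFinset_val, (jacobiP_roots_nodup N).dedup]
  have hcard : S.card = N := by
    rw [← Finset.card_val, hval, splits_iff_card_roots.1 (jacobiP_splits N), natDegree_jacobiP]
  set e := S.orderEmbOfFin hcard with he
  refine ⟨fun n => if h : n < N then e (Fin.rev ⟨n, h⟩) else 0, ?_, ?_, ?_⟩
  · intro n n' h h'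
    simp only [h', h.trans h', dif_pos]
    exact e.strictMono (Fin.rev_lt_rev.2 h)
  · intro n h
    simp only [h, dif_pos]
    have : e (Fin.rev ⟨n, h⟩) ∈ S := S.orderEmbOfFin_mem hcard _
    exact abs_lt.1 (abs_lt_one_of_isRoot_jacobiP
      (isRoot_of_mem_roots (Multiset.mem_toFinset.1 (hS ▸ this))))
  · conv_lhs => rw [(jacobiP_splits N).eq_prod_roots, ← hval]
    congr 1
    rw [← Fin.prod_univ_eq_prod_range (fun n => X - C (if h : n < N then e (Fin.rev ⟨n, h⟩) else 0))]
    simp only [Fin.is_lt, dif_pos, Fin.eta]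
    change _ = ∏ i, (X - C (e (Fin.revPerm i)))
    rw [Equiv.prod_comp Fin.revPerm (fun i => X - C (e i))]
    change ∏ a ∈ S, (X - C a) = _
    rw [← Finset.image_orderEmbOfFin_univ S hcard, Finset.prod_image e.injective.injOn]

@[to_additive]
theorem prod_comp_placement {β : Type*} [CommMonoid β] (F : ℝ → β) (N : ℕ) (x : ℕ → ℝ) :
    ∏ m, F (placement (N + 2) x m) = F (-1) * F 1 * ∏ n ∈ Finset.range N, F (x n) := by
  rw [Fin.prod_univ_succ, Fin.prod_univ_castSucc]
  have h : ∀ j : Fin N, placement (N + 2) x (j.castSucc.succ) = x (Fin.revPerm j) := by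
    intro j
    have := j.2
    rw [placement, if_neg (by simp), if_neg (by simp; omega)]
    congr 1
  have h0 : placement (N + 2) x 0 = -1 := by simp [placement]
  have h1 : placement (N + 2) x (Fin.last N).succ = 1 := by simp [placement]
  simp only [h, h0, h1]
  rw [Equiv.prod_comp Fin.revPerm (fun j : Fin N => F (x j)),
    Fin.prod_univ_eq_prod_range (fun n => F (x n)), mul_assoc, mul_comm (F 1)]

theorem prod_X_sub_C_placement (N : ℕ) (x : ℕ → ℝ) :
    ∏ m, (Polynomial.X - Polynomial.C (placement (N + 2) x m)) =
      (Polynomial.X ^ 2 - 1) * ∏ n ∈ Finset.range N, (Polynomial.X - Polynomial.C (x n)) := by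
  rw [prod_comp_placement (fun a => Polynomial.X - Polynomial.C a), map_neg, map_one]
  ring

theorem strictMono_placement {N : ℕ} {x : ℕ → ℝ} (h1 : ∀ n n' : ℕ, n < n' → n' < N → x n' < x n)
    (h2 : ∀ n : ℕ, n < N → x n ∈ Set.Ioo (-1 : ℝ) 1) : StrictMono (placement (N + 2) x) := by
  intro i j hij
  have hj := j.2
  have hij' : (i : ℕ) < j := hij
  unfold placement
  split_ifs with a b c d e f
  · omega
  · norm_num
  · exact (h2 _ (by omega)).1
  · omega
  · omega
  · omega
  · omega
  · exact (h2 _ (by omega)).2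
  · exact h1 _ _ (by omega) (by omega)

open Polynomial in
/-- A monic polynomial solution of `(x² - 1) u'' = n (n - 1) u` is determined by its degree. -/
theorem eq_of_X_sq_sub_one_mul_derivative_derivative {P Q : ℝ[X]} (hP : P.Monic) (hQ : Q.Monic)
    (h : P.natDegree = Q.natDegree) {n : ℕ} (hn : P.natDegree = n + 2)
    (hP' : (X ^ 2 - 1) * derivative (derivative P) = C (((n : ℝ) + 1) * ((n : ℝ) + 2)) * P)
    (hQ' : (X ^ 2 - 1) * derivative (derivative Q) = C (((n : ℝ) + 1) * ((n : ℝ) + 2)) * Q) :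
    P = Q := by
  by_contra hne
  set D := P - Q with hD
  have hD0 : D ≠ 0 := sub_ne_zero.2 hne
  have hdeg : D.natDegree < n + 2 := by
    have h1 : (P - Q).degree < P.degree := degree_sub_lt_left
      (by rw [degree_eq_natDegree hP.ne_zero, degree_eq_natDegree hQ.ne_zero, h]) hP.ne_zero (by rw [hP.leadingCoeff, hQ.leadingCoeff])
    rw [← hn]
    exact natDegree_lt_natDegree hD0 h1
  have hode : (X ^ 2 - 1) * derivative (derivative D) =
      C (((n : ℝ) + 1) * ((n : ℝ) + 2)) * D := by
    rw [hD, derivative_sub, derivative_sub]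
    linear_combination hP' - hQ'
  have hc := congrArg (fun p : ℝ[X] => p.coeff D.natDegree) hode
  have hlc : D.coeff D.natDegree ≠ 0 := by simpa using hD0
  have hz : D.coeff (D.natDegree + 1 + 1) = 0 := coeff_eq_zero_of_natDegree_lt (by omega)
  have hc' : (D.natDegree : ℝ) * ((D.natDegree : ℝ) - 1) * D.coeff D.natDegree =
      ((n : ℝ) + 1) * ((n : ℝ) + 2) * D.coeff D.natDegree := by
    simp only [sub_mul, one_mul, coeff_sub, coeff_C_mul, mul_comm (X ^ 2 : ℝ[X])] at hc
    rw [coeff_mul_X_pow'] at hc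
    simp only [coeff_derivative, hz] at hc
    rw [← hc]
    split_ifs with h2
    · obtain ⟨k, hk⟩ := Nat.exists_eq_add_of_le' h2
      rw [hk]
      push_cast
      simp
      ring
    · have : D.natDegree = 0 ∨ D.natDegree = 1 := by omega
      rcases this with h | h <;> simp [h]
  have h3 := mul_right_cancel₀ hlc hc'
  have h4 : (D.natDegree : ℝ) ≤ n + 1 := by exact_mod_cast Nat.lt_succ_iff.1 hdeg
  have h5 : (0 : ℝ) ≤ D.natDegree := Nat.cast_nonneg _
  nlinarith

open Polynomial in
/-- The polynomial whose zeros are the points of an equilibrium placement on `[-1,1]`. -/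
theorem IsEquilibriumPlacement.X_sq_sub_one_mul_derivative_derivative {N : ℕ} {t : Fin (N + 2) → ℝ}
    (ht : IsEquilibriumPlacement (-1) 1 t) :
    (X ^ 2 - 1) * derivative (derivative (∏ i, (X - C (t i)))) =
      C (((N : ℝ) + 1) * ((N : ℝ) + 2)) * ∏ i, (X - C (t i)) := by
  obtain ⟨hmono, h0, h1, heq⟩ := ht
  set P := ∏ i, (X - C (t i)) with hP
  have hPm : P.Monic := monic_prod_of_monic _ _ fun i _ => monic_X_sub_C _
  have hPd : P.natDegree = N + 2 := by
    rw [hP, natDegree_prod_of_monic _ _ fun i _ => monic_X_sub_C _]; simp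
  set D := (X ^ 2 - 1) * derivative (derivative P) - C (((N : ℝ) + 1) * ((N : ℝ) + 2)) * P with hD
  suffices D = 0 from sub_eq_zero.1 this
  have hdeg : D.natDegree ≤ N + 1 := by
    refine natDegree_le_iff_coeff_eq_zero.2 fun k hk => ?_
    have hz : P.coeff (k + 1 + 1) = 0 := coeff_eq_zero_of_natDegree_lt (by omega)
    rw [hD]
    simp only [sub_mul, one_mul, coeff_sub, coeff_C_mul, mul_comm (X ^ 2 : ℝ[X])]
    rw [coeff_mul_X_pow', if_pos (by omega)]
    simp only [coeff_derivative, hz]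
    obtain ⟨j, rfl⟩ := Nat.exists_eq_add_of_le' (show 2 ≤ k by omega)
    simp only [Nat.add_sub_cancel]
    rcases (show N ≤ j by omega).eq_or_lt with rfl | hj
    · push_cast; ring
    · rw [coeff_eq_zero_of_natDegree_lt (p := P) (by omega)]; simp
  refine eq_zero_of_natDegree_lt_card_of_eval_eq_zero D hmono.injective (fun m => ?_)
    (by rw [Fintype.card_fin]; omega)
  have hPe : P.eval (t m) = 0 := by
    rw [hP, eval_prod]; exact Finset.prod_eq_zero (Finset.mem_univ m) (by simp)
  rw [hD, eval_sub, eval_mul, eval_mul, hPe, mul_zero, sub_zero]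
  by_cases c0 : (m : ℕ) = 0
  · rw [h0 m c0]; simp
  by_cases c1 : (m : ℕ) + 1 = N + 2
  · rw [h1 m c1]; simp
  rw [eval_derivative_derivative_prod hmono.injective, heq m (by omega) (by omega)]
  simp

open Polynomial in
theorem isEquilibriumPlacement_neg_one_one_iff {N : ℕ} {x : ℕ → ℝ}
    (h1 : ∀ n n' : ℕ, n < n' → n' < N → x n' < x n)
    (h2 : ∀ n : ℕ, n < N → x n ∈ Set.Ioo (-1 : ℝ) 1)
    (h3 : jacobiP 1 1 N = C (jacobiP 1 1 N).leadingCoeff *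
      ∏ n ∈ Finset.range N, (X - C (x n))) (t : Fin (N + 2) → ℝ) :
    IsEquilibriumPlacement (-1) 1 t ↔ t = placement (N + 2) x := by
  have hmono := strictMono_placement h1 h2
  set Q := ∏ m, (X - C (placement (N + 2) x m)) with hQ
  have hlc : (jacobiP 1 1 N).leadingCoeff ≠ 0 := leadingCoeff_ne_zero.2 (jacobiP_ne_zero N)
  have hu : (X ^ 2 - 1) * jacobiP 1 1 N = C (jacobiP 1 1 N).leadingCoeff * Q := by
    rw [hQ, prod_X_sub_C_placement, h3]
    simp only [leadingCoeff_mul, leadingCoeff_C]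
    rw [(monic_prod_of_monic _ _ fun i _ => monic_X_sub_C _).leadingCoeff]
    rw [mul_one]; ring
  have hode : (X ^ 2 - 1) * derivative (derivative Q) =
      C (((N : ℝ) + 1) * ((N : ℝ) + 2)) * Q := by
    have h := X_sq_sub_one_mul_derivative_derivative N
    rw [hu, derivative_C_mul, derivative_C_mul] at h
    apply mul_left_cancel₀ (C_ne_zero.2 hlc)
    linear_combination h
  constructor
  · intro ht
    have hPQ : ∏ i, (X - C (t i)) = Q := by
      refine eq_of_X_sq_sub_one_mul_derivative_derivative
        (monic_prod_of_monic _ _ fun i _ => monic_X_sub_C _)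
        (monic_prod_of_monic _ _ fun i _ => monic_X_sub_C _) ?_ (n := N) ?_
        ht.X_sq_sub_one_mul_derivative_derivative hode
      · rw [natDegree_prod_of_monic _ _ fun i _ => monic_X_sub_C _,
          natDegree_prod_of_monic _ _ fun i _ => monic_X_sub_C _]
        simp
      · rw [natDegree_prod_of_monic _ _ fun i _ => monic_X_sub_C _]
        simp
    refine (StrictMono.range_inj ht.1 hmono).1 (Set.ext fun z => ?_)
    have hz := congrArg (fun p => p.eval z = 0) hPQ
    simp only [hQ, eval_prod, Finset.prod_eq_zero_iff, eval_sub, eval_X, eval_C, sub_eq_zero,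
      Finset.mem_univ, true_and, eq_iff_iff] at hz
    simpa [eq_comm] using hz
  · rintro rfl
    refine ⟨hmono, fun m hm => by simp [placement, hm], fun m hm => ?_, fun m hm hm' => ?_⟩
    · rw [placement, if_neg (by omega), if_pos hm]
    · have hx : placement (N + 2) x m ∈ Set.Ioo (-1 : ℝ) 1 := by
        rw [placement, if_neg (by omega), if_neg (by omega)]
        exact h2 _ (by omega)
      have h := congrArg (eval (placement (N + 2) x m)) hode
      have hQe : Q.eval (placement (N + 2) x m) = 0 := by
        rw [hQ, eval_prod]; exact Finset.prod_eq_zero (Finset.mem_univ m) (by simp)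
      rw [eval_mul, eval_mul, hQe, mul_zero, hQ,
        eval_derivative_derivative_prod hmono.injective] at h
      have hsq : placement (N + 2) x m ^ 2 - 1 ≠ 0 := by nlinarith [hx.1, hx.2]
      have hprod : ∏ i ∈ Finset.univ.erase m,
          (placement (N + 2) x m - placement (N + 2) x i) ≠ 0 :=
        Finset.prod_ne_zero_iff.2 fun i hi => sub_ne_zero.2 fun h =>
          (Finset.mem_erase.1 hi).1 (hmono.injective h).symm
      simpa [hsq, hprod] using h

theorem isEquilibriumPlacement_iff_toNormalized {M : ℕ} {a b : ℝ} (hab : a < b) (s : Fin M → ℝ) :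
    IsEquilibriumPlacement a b s ↔
      IsEquilibriumPlacement (-1) 1 (fun m => toNormalized a b (s m)) := by
  have hba : 0 < b - a := sub_pos.2 hab
  unfold IsEquilibriumPlacement
  refine and_congr ?_ (and_congr ?_ (and_congr ?_ ?_))
  · refine forall_congr' fun i => forall_congr' fun j => imp_congr_right fun _ => ?_
    simp only [toNormalized]
    rw [div_lt_div_iff_of_pos_right hba]
    constructor <;> intro h <;> linarith
  · refine forall_congr' fun i => imp_congr_right fun _ => ?_
    simp only [toNormalized]
    rw [div_eq_iff hba.ne']
    constructor <;> intro h <;> linarith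
  · refine forall_congr' fun i => imp_congr_right fun _ => ?_
    simp only [toNormalized]
    rw [div_eq_iff hba.ne']
    constructor <;> intro h <;> linarith
  · refine forall_congr' fun m => imp_congr_right fun _ => imp_congr_right fun _ => ?_
    have : ∀ i, 1 / (toNormalized a b (s m) - toNormalized a b (s i)) =
        (b - a) / 2 * (1 / (s m - s i)) := by
      intro i
      rw [toNormalized, toNormalized, ← sub_div]
      rw [show 2 * s m - (a + b) - (2 * s i - (a + b)) = 2 * (s m - s i) by ring, one_div_div,
        mul_one_div, div_div]
    simp only [this]
    rw [← Finset.mul_sum, mul_eq_zero, or_iff_right (by positivity)]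

theorem toNormalized_eq_iff {a b : ℝ} (hab : a < b) {s t : ℝ} :
    toNormalized a b s = t ↔ s = toAngular a b t := by
  have hba : 0 < b - a := sub_pos.2 hab
  rw [toNormalized, toAngular, div_eq_iff hba.ne']
  constructor <;> intro h <;> linarith

open Polynomial in
theorem jacobiP_differential_equation (N : ℕ) (x : ℝ) :
    (1 - x ^ 2) * (derivative (derivative (jacobiP 1 1 N))).eval x =
      4 * x * (derivative (jacobiP 1 1 N)).eval x - N * (N + 3) * (jacobiP 1 1 N).eval x := by
  have h := X_sq_sub_one_mul_derivative_derivative N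
  rw [mul_left_comm] at h
  have h := congrArg (eval x) (mul_left_cancel₀ X_sq_sub_one_ne_zero h)
  simp only [derivative_mul, derivative_add, derivative_sub, derivative_X_pow, derivative_one,
    eval_add, eval_mul, eval_sub, eval_pow, eval_X, eval_C, eval_one, sub_zero, derivative_C] at h
  norm_num at h
  linear_combination -h

/-- A Sturm type separation bound for the zeros of `θ ↦ sin θ * P_N^{(1,1)} (cos θ)`. -/
theorem pi_le_mul_sub_of_sin_mul_jacobiP_eq_zero {N : ℕ} {α β : ℝ} (h0 : 0 ≤ α) (hαβ : α < β)
    (hπ : β ≤ Real.pi) (hα : Real.sin α * (jacobiP 1 1 N).eval (Real.cos α) = 0)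
    (hβ : Real.sin β * (jacobiP 1 1 N).eval (Real.cos β) = 0) :
    Real.pi ≤ (N + 3 / 2) * (β - α) := by
  open Polynomial in
  by_contra! hlt
  set y := jacobiP 1 1 N with hy
  set k : ℝ := N + 3 / 2 with hk
  have hkpos : 0 < k := by positivity
  set m := (α + β) / 2 with hm
  have hcos : ∀ θ ∈ Set.Icc α β, 0 < Real.cos (k * (θ - m)) := by
    intro θ hθ
    have e1 : k * (α - m) ≤ k * (θ - m) := by gcongr; exact hθ.1
    have e2 : k * (θ - m) ≤ k * (β - m) := by gcongr; exact hθ.2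
    have e3 : k * (α - m) = -(k * (β - α) / 2) := by rw [hm]; ring
    have e4 : k * (β - m) = k * (β - α) / 2 := by rw [hm]; ring
    exact Real.cos_pos_of_mem_Ioo ⟨by linarith, by linarith⟩
  -- Picone's identity for the comparison function `cos (k (θ - m))`
  set F : ℝ → ℝ := fun θ =>
    3 / 2 * Real.sin θ ^ 2 * Real.cos θ * y.eval (Real.cos θ) ^ 2
      - Real.sin θ ^ 4 * (y.eval (Real.cos θ) * (derivative y).eval (Real.cos θ))
      + k * Real.sin θ ^ 3 * y.eval (Real.cos θ) ^ 2 * Real.tan (k * (θ - m)) with hF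
  set A : ℝ → ℝ := fun θ => 3 / 2 * Real.cos θ * y.eval (Real.cos θ)
    - Real.sin θ ^ 2 * (derivative y).eval (Real.cos θ)
    + k * Real.sin θ * y.eval (Real.cos θ) * Real.tan (k * (θ - m)) with hA
  have hderiv : ∀ θ ∈ Set.Icc α β,
      HasDerivAt F (Real.sin θ * (A θ ^ 2 + 3 / 4 * y.eval (Real.cos θ) ^ 2)) θ := by
    intro θ hθ
    have hs := Real.hasDerivAt_sin θ
    have hc := Real.hasDerivAt_cos θ
    have hY := (y.hasDerivAt (Real.cos θ)).comp θ hc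
    have hZ := ((derivative y).hasDerivAt (Real.cos θ)).comp θ hc
    have hT := (Real.hasDerivAt_tan (hcos θ hθ).ne').comp θ
      (((hasDerivAt_id θ).sub_const m).const_mul k)
    have h := (((((hs.pow 2).const_mul (3 / 2)).mul hc).mul (hY.pow 2)).sub
      ((hs.pow 4).mul (hY.mul hZ))).add ((((hs.pow 3).const_mul k).mul (hY.pow 2)).mul hT)
    refine h.congr_deriv ?_
    have hode := jacobiP_differential_equation N (Real.cos θ)
    rw [← hy] at hode
    have hT2 : 1 / Real.cos (k * (θ - m)) ^ 2 = 1 + Real.tan (k * (θ - m)) ^ 2 := by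
      rw [Real.tan_eq_sin_div_cos, div_pow, ← sub_eq_iff_eq_add, ← sub_div,
        ← Real.cos_sq', div_self (pow_ne_zero 2 (hcos θ hθ).ne')]
    have hcs := Real.sin_sq_add_cos_sq θ
    simp only [hA, Function.comp_def, Pi.mul_apply, Pi.pow_apply, id, Nat.cast_ofNat,
      Nat.add_one_sub_one]
    rw [hT2]
    generalize (derivative (derivative y)).eval (Real.cos θ) = W at *
    generalize (derivative y).eval (Real.cos θ) = Z at *
    generalize y.eval (Real.cos θ) = Y at *
    generalize Real.tan (k * (θ - m)) = T at *
    generalize Real.sin θ = s at *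
    generalize Real.cos θ = c at *
    have hN : (N : ℝ) = k - 3 / 2 := by rw [hk]; ring
    rw [hN] at hode
    linear_combination s ^ 3 * Y * hode + (s ^ 3 * Y * W + 3 / 4 * s * Y ^ 2) * hcs
  have hsin : ∀ θ ∈ Set.Icc α β, 0 ≤ Real.sin θ := fun θ hθ =>
    Real.sin_nonneg_of_nonneg_of_le_pi (h0.trans hθ.1) (hθ.2.trans hπ)
  have hmono : MonotoneOn F (Set.Icc α β) := by
    refine monotoneOn_of_deriv_nonneg (convex_Icc α β)
      (fun θ hθ => (hderiv θ hθ).continuousAt.continuousWithinAt)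
      (fun θ hθ => (hderiv θ (interior_subset hθ)).differentiableAt.differentiableWithinAt)
      fun θ hθ => ?_
    rw [(hderiv θ (interior_subset hθ)).deriv]
    have := hsin θ (interior_subset hθ)
    positivity
  have hzero : ∀ θ, Real.sin θ * y.eval (Real.cos θ) = 0 → F θ = 0 := by
    intro θ h
    rw [hF]
    linear_combination (3 / 2 * Real.sin θ * Real.cos θ * y.eval (Real.cos θ)
      - Real.sin θ ^ 3 * (derivative y).eval (Real.cos θ)
      + k * Real.sin θ ^ 2 * y.eval (Real.cos θ) * Real.tan (k * (θ - m))) * h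
  have hF0 : ∀ θ ∈ Set.Icc α β, F θ = 0 := fun θ hθ =>
    le_antisymm ((hmono hθ (Set.right_mem_Icc.2 hαβ.le) hθ.2).trans_eq (hzero β hβ))
      ((hzero α hα).symm.trans_le (hmono (Set.left_mem_Icc.2 hαβ.le) hθ hθ.1))
  have hroot : ∀ θ ∈ Set.Ioo α β, y.IsRoot (Real.cos θ) := by
    intro θ hθ
    have hd := hderiv θ (Set.Ioo_subset_Icc_self hθ)
    have h00 : HasDerivAt F 0 θ := (hasDerivAt_const θ (0 : ℝ)).congr_of_eventuallyEq <| by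
      filter_upwards [Icc_mem_nhds hθ.1 hθ.2] with z hz using hF0 z hz
    have h1 := hd.unique h00
    have hspos : 0 < Real.sin θ :=
      Real.sin_pos_of_pos_of_lt_pi (h0.trans_lt hθ.1) (hθ.2.trans_le hπ)
    have h2 := (mul_eq_zero.1 h1).resolve_left hspos.ne'
    have h3 : y.eval (Real.cos θ) ^ 2 = 0 := by
      nlinarith [sq_nonneg (A θ), sq_nonneg (y.eval (Real.cos θ))]
    exact pow_eq_zero_iff two_ne_zero |>.1 h3
  refine jacobiP_ne_zero N (eq_zero_of_infinite_isRoot y ?_)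
  refine ((Set.Ioo_infinite hαβ).image (f := Real.cos) (Real.injOn_cos.mono fun θ hθ => ?_)).mono ?_
  · exact ⟨h0.trans hθ.1.le, hθ.2.le.trans hπ⟩
  · rintro _ ⟨θ, hθ, rfl⟩
    exact hroot θ hθ

theorem abs_sub_chebyshevNode_le {N : ℕ} {x : ℕ → ℝ}
    (h1 : ∀ n n' : ℕ, n < n' → n' < N → x n' < x n)
    (h2 : ∀ n : ℕ, n < N → x n ∈ Set.Ioo (-1 : ℝ) 1)
    (h3 : ∀ n : ℕ, n < N → (jacobiP 1 1 N).IsRoot (x n)) {n : ℕ} (hn : n < N) :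
    |x n - chebyshevNode N n| ≤ Real.pi / N := by
  have hcos : ∀ i < N, Real.cos (Real.arccos (x i)) = x i := fun i hi =>
    Real.cos_arccos (h2 i hi).1.le (h2 i hi).2.le
  have hzero : ∀ i < N, Real.sin (Real.arccos (x i)) *
      (jacobiP 1 1 N).eval (Real.cos (Real.arccos (x i))) = 0 := fun i hi => by
    rw [hcos i hi, h3 i hi, mul_zero]
  have hlow : ∀ i < N, (i + 1) * Real.pi ≤ (N + 3 / 2) * Real.arccos (x i) := by
    intro i
    induction i with
    | zero =>
      intro hi
      have := pi_le_mul_sub_of_sin_mul_jacobiP_eq_zero le_rfl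
        (Real.arccos_pos.2 (h2 0 hi).2) (Real.arccos_le_pi _) (by simp) (hzero 0 hi)
      simpa using this
    | succ i ih =>
      intro hi
      have hi' : i < N := by omega
      have := pi_le_mul_sub_of_sin_mul_jacobiP_eq_zero (Real.arccos_nonneg _)
        (Real.strictAntiOn_arccos ⟨(h2 _ hi).1.le, (h2 _ hi).2.le⟩
          ⟨(h2 _ hi').1.le, (h2 _ hi').2.le⟩ (h1 i (i + 1) (by omega) hi))
        (Real.arccos_le_pi _) (hzero i hi') (hzero _ hi)
      have := ih hi'
      push_cast
      linarith
  have hup : ∀ j i : ℕ, i + j + 1 = N →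
      (j + 1) * Real.pi ≤ (N + 3 / 2) * (Real.pi - Real.arccos (x i)) := by
    intro j
    induction j with
    | zero =>
      intro i hi
      have hi' : i < N := by omega
      have := pi_le_mul_sub_of_sin_mul_jacobiP_eq_zero (Real.arccos_nonneg _)
        (lt_of_le_of_ne (Real.arccos_le_pi (x i))
          fun h => (h2 i hi').1.not_ge (Real.arccos_eq_pi.1 h)) le_rfl (hzero i hi') (by simp)
      simpa using this
    | succ j ih =>
      intro i hi
      have hi' : i < N := by omega
      have hi'' : i + 1 < N := by omega
      have := pi_le_mul_sub_of_sin_mul_jacobiP_eq_zero (Real.arccos_nonneg _)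
        (Real.strictAntiOn_arccos ⟨(h2 _ hi'').1.le, (h2 _ hi'').2.le⟩
          ⟨(h2 _ hi').1.le, (h2 _ hi').2.le⟩ (h1 i (i + 1) (by omega) hi''))
        (Real.arccos_le_pi _) (hzero i hi') (hzero _ hi'')
      have := ih (i + 1) (by omega)
      push_cast
      linarith
  have hl := hlow n hn
  obtain ⟨j, hj⟩ := Nat.exists_eq_add_of_lt hn
  have hu := hup j n hj.symm
  rw [← hcos n hn, chebyshevNode]
  refine (Real.abs_cos_sub_cos_le _ _).trans ?_
  have hN : (0 : ℝ) < N := by exact_mod_cast (Nat.zero_le n).trans_lt hn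
  have hNj : (N : ℝ) = n + j + 1 := by exact_mod_cast hj
  have hpi := Real.pi_pos
  set θ := Real.arccos (x n)
  have hθ0 : 0 ≤ θ := Real.arccos_nonneg _
  have hθπ : θ ≤ Real.pi := Real.arccos_le_pi _
  rw [le_div_iff₀ hN, ← abs_of_pos hN, ← abs_mul, abs_of_pos hN, sub_mul,
    show (2 * (n : ℝ) + 1) * Real.pi / (2 * N) * N = (n + 1 / 2) * Real.pi by field_simp,
    abs_le, hNj]
  rw [hNj] at hl hu
  constructor <;> linarith

theorem integral_arcsineMeasure (f : ℝ → ℝ) :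
    ∫ u, f u ∂arcsineMeasure = (∫ θ in 0..Real.pi, f (Real.cos θ)) / Real.pi := by
  rw [← Polynomial.Chebyshev.integral_measureT_eq_integral_cos,
    Polynomial.Chebyshev.integral_measureT, intervalIntegral.integral_of_le (by norm_num),
    integral_Ioc_eq_integral_Ioo, arcsineMeasure, withDensity_indicator measurableSet_Ioo,
    integral_withDensity_eq_integral_toReal_smul (by fun_prop)
      (.of_forall fun _ => ENNReal.ofReal_lt_top), ← integral_div]
  refine integral_congr_ae (.of_forall fun u => ?_)
  have : 0 ≤ 1 / (Real.pi * √(1 - u ^ 2)) := by have := Real.pi_pos; positivity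
  simp only [ENNReal.toReal_ofReal this, smul_eq_mul]
  rw [Real.sqrt_inv, one_div, mul_inv]
  ring

theorem tendsto_midpoint_sum {g : ℝ → ℝ} (hg : Continuous g) :
    Tendsto (fun N : ℕ => (∑ n ∈ Finset.range N,
      g ((2 * (n : ℝ) + 1) * Real.pi / (2 * (N : ℝ)))) / (N : ℝ)) atTop
      (𝓝 ((∫ θ in 0..Real.pi, g θ) / Real.pi)) := by
  have hpi := Real.pi_pos
  have huc := isCompact_Icc.uniformContinuousOn_of_continuous (s := Set.Icc 0 Real.pi) hg.continuousOn
  rw [Metric.uniformContinuousOn_iff] at huc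
  rw [Metric.tendsto_atTop]
  intro ε hε
  obtain ⟨δ, hδ, hgδ⟩ := huc (ε / 2) (by positivity)
  obtain ⟨N₀, hN₀⟩ := exists_nat_gt (Real.pi / δ)
  refine ⟨N₀ + 1, fun N hN => ?_⟩
  have hNpos : (0 : ℝ) < N := by exact_mod_cast (Nat.succ_pos _).trans_le hN
  have hNδ : Real.pi / N < δ := by
    rw [div_lt_comm₀ hNpos hδ]
    exact hN₀.trans (by exact_mod_cast hN)
  set a : ℕ → ℝ := fun n => n * (Real.pi / N) with ha
  have haN : a N = Real.pi := by simp only [ha]; field_simp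
  have ha0 : a 0 = 0 := by simp [ha]
  have hsucc : ∀ n, a (n + 1) = a n + Real.pi / N := fun n => by simp only [ha]; push_cast; ring
  have hamono : Monotone a := monotone_nat_of_le_succ fun n => by
    rw [hsucc]; linarith [div_pos hpi hNpos]
  have hint : ∑ n ∈ Finset.range N, ∫ θ in a n..a (n + 1), g θ = ∫ θ in 0..Real.pi, g θ := by
    rw [intervalIntegral.sum_integral_adjacent_intervals fun n _ => hg.intervalIntegrable _ _,
      ha0, haN]
  have hcell : ∀ n ∈ Finset.range N,
      |Real.pi / N * g ((2 * (n : ℝ) + 1) * Real.pi / (2 * (N : ℝ)))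
        - ∫ θ in a n..a (n + 1), g θ| ≤ ε / 2 * (Real.pi / N) := by
    intro n hn
    have hnN : n + 1 ≤ N := Finset.mem_range.1 hn
    set c := (2 * (n : ℝ) + 1) * Real.pi / (2 * (N : ℝ)) with hc
    have hcm : c = a n + Real.pi / N / 2 := by rw [hc, ha]; field_simp
    have hw : 0 < Real.pi / N := div_pos hpi hNpos
    have h0 : 0 ≤ a n := by rw [← ha0]; exact hamono (Nat.zero_le n)
    have h1 : a (n + 1) ≤ Real.pi := by rw [← haN]; exact hamono hnN
    have hs := hsucc n
    have hconst : Real.pi / N * g c = ∫ _ in a n..a (n + 1), g c := by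
      rw [intervalIntegral.integral_const, hs, smul_eq_mul, add_sub_cancel_left]
    rw [hconst, ← intervalIntegral.integral_sub (by simp) (hg.intervalIntegrable _ _)]
    have hb := intervalIntegral.norm_integral_le_of_norm_le_const (a := a n) (b := a (n + 1))
      (f := fun θ => g c - g θ) (C := ε / 2) fun θ hθ => ?_
    · rw [hs, add_sub_cancel_left, abs_of_pos hw, ← hs] at hb
      exact hb
    · rw [Set.uIoc_of_le (by linarith)] at hθ
      have := hgδ c ⟨by linarith, by linarith⟩ θ ⟨by linarith [hθ.1], by linarith [hθ.2]⟩ (by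
        rw [Real.dist_eq, abs_lt]; constructor <;> linarith [hθ.1, hθ.2])
      rw [Real.dist_eq] at this
      exact this.le
  have hsum : |Real.pi / N * (∑ n ∈ Finset.range N,
      g ((2 * (n : ℝ) + 1) * Real.pi / (2 * (N : ℝ)))) - ∫ θ in 0..Real.pi, g θ|
      ≤ ε / 2 * Real.pi := by
    rw [← hint, Finset.mul_sum, ← Finset.sum_sub_distrib]
    refine (Finset.abs_sum_le_sum_abs _ _).trans ((Finset.sum_le_sum hcell).trans_eq ?_)
    rw [Finset.sum_const, Finset.card_range, nsmul_eq_mul]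
    field_simp
  rw [Real.dist_eq]
  set S := ∑ n ∈ Finset.range N, g ((2 * (n : ℝ) + 1) * Real.pi / (2 * (N : ℝ)))
  have : S / N - (∫ θ in 0..Real.pi, g θ) / Real.pi =
      (Real.pi / N * S - ∫ θ in 0..Real.pi, g θ) / Real.pi := by field_simp
  rw [this, abs_div, abs_of_pos hpi, div_lt_iff₀ hpi]
  nlinarith

theorem empiricalTendsto_closedFormPlacement :
    EmpiricalTendsto closedFormPlacement arcsineMeasure := by
  intro f
  rw [← tendsto_add_atTop_iff_nat 2, integral_arcsineMeasure]
  have h1 := tendsto_midpoint_sum (f.continuous.comp Real.continuous_cos)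
  have h2 : Tendsto (fun N : ℕ => (N : ℝ) / (N + 2)) atTop (𝓝 1) :=
    tendsto_natCast_div_add_atTop (2 : ℝ)
  have h3 : Tendsto (fun N : ℕ => (f (-1) + f 1) / ((N + 2 : ℕ) : ℝ)) atTop (𝓝 0) :=
    (tendsto_const_div_atTop_nhds_zero_nat (f (-1) + f 1)).comp (tendsto_add_atTop_nat 2)
  have h4 := h3.add (h1.mul h2)
  rw [zero_add, mul_one] at h4
  refine h4.congr fun N => ?_
  simp only [closedFormPlacement, Nat.add_sub_cancel]
  rw [sum_comp_placement f]
  simp only [Function.comp_apply, chebyshevNode]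
  rcases N.eq_zero_or_pos with rfl | hN
  · simp
  · have : (N : ℝ) ≠ 0 := by exact_mod_cast hN.ne'
    generalize ∑ n ∈ Finset.range N, f (Real.cos ((2 * (n : ℝ) + 1) * Real.pi / (2 * N))) = S
    push_cast
    field_simp

/-- Configurations in `[-1,1]` that are uniformly close have the same limiting distribution. -/
theorem EmpiricalTendsto.of_abs_sub_lt {t τ : (M : ℕ) → Fin M → ℝ} {μ : Measure ℝ}
    (hτ : EmpiricalTendsto τ μ)
    (ht1 : ∀ᶠ M in atTop, ∀ m, t M m ∈ Set.Icc (-1 : ℝ) 1)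
    (hτ1 : ∀ᶠ M in atTop, ∀ m, τ M m ∈ Set.Icc (-1 : ℝ) 1)
    (h : ∀ ε : ℝ, 0 < ε → ∀ᶠ M in atTop, ∀ m, |t M m - τ M m| < ε) :
    EmpiricalTendsto t μ := by
  intro f
  refine (tendsto_iff_of_dist ?_).1 (hτ f)
  rw [Metric.tendsto_nhds]
  intro ε hε
  have huc := isCompact_Icc.uniformContinuousOn_of_continuous (s := Set.Icc (-1 : ℝ) 1)
    f.continuous.continuousOn
  rw [Metric.uniformContinuousOn_iff] at huc
  obtain ⟨δ, hδ, hfδ⟩ := huc (ε / 2) (by positivity)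
  filter_upwards [ht1, hτ1, h δ hδ, eventually_gt_atTop 0] with M h1 h2 h3 hM
  have hM' : (0 : ℝ) < M := by exact_mod_cast hM
  rw [dist_zero_right, Real.norm_eq_abs, abs_of_nonneg dist_nonneg, Real.dist_eq, ← sub_div,
    ← Finset.sum_sub_distrib, abs_div, abs_of_pos hM', div_lt_iff₀ hM']
  calc |∑ m, (f (τ M m) - f (t M m))| ≤ ∑ m, |f (τ M m) - f (t M m)| :=
        Finset.abs_sum_le_sum_abs _ _
    _ ≤ ∑ _m : Fin M, ε / 2 := by
        refine Finset.sum_le_sum fun m _ => ?_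
        rw [abs_sub_comm]
        exact (hfδ _ (h1 m) _ (h2 m) (h3 m)).le
    _ < ε * M := by
        rw [Finset.sum_const, Finset.card_univ, Fintype.card_fin, nsmul_eq_mul]
        nlinarith

theorem placement_mem_Icc {N : ℕ} {x : ℕ → ℝ} (hx : ∀ n < N, x n ∈ Set.Icc (-1 : ℝ) 1)
    (m : Fin (N + 2)) : placement (N + 2) x m ∈ Set.Icc (-1 : ℝ) 1 := by
  unfold placement
  split_ifs
  · norm_num
  · norm_num
  · exact hx _ (by omega)

theorem abs_placement_sub_placement_lt {N : ℕ} {x y : ℕ → ℝ} {ε : ℝ} (hε : 0 < ε)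
    (h : ∀ n < N, |x n - y n| < ε) (m : Fin (N + 2)) :
    |placement (N + 2) x m - placement (N + 2) y m| < ε := by
  unfold placement
  split_ifs
  · simpa
  · simpa
  · exact h _ (by omega)

theorem proposition2 :
    ∃ x : ℕ → ℕ → ℝ,
      -- `x N 0 > ⋯ > x N (N-1)` are all the (real or complex) zeros of `P_N^{(1,1)}`
      (∀ N : ℕ,
        (∀ n n' : ℕ, n < n' → n' < N → x N n' < x N n) ∧
        (∀ n : ℕ, n < N → x N n ∈ Set.Ioo (-1 : ℝ) 1) ∧
        (∀ z : ℂ, Polynomial.aeval z (jacobiP 1 1 N) = 0 ↔ ∃ n : ℕ, n < N ∧ z = (x N n : ℂ))) ∧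
      -- they converge to the Chebyshev nodes, uniformly in the index
      (∀ ε : ℝ, 0 < ε → ∀ᶠ N : ℕ in atTop,
        ∀ n : ℕ, n < N → |x N n - chebyshevNode N n| < ε) ∧
      -- the unique equilibrium placement of `M` antennas on `[a,b]` is given by these zeros
      (∀ (M : ℕ) (a b : ℝ), 2 ≤ M → a < b → ∀ s : Fin M → ℝ,
        IsEquilibriumPlacement a b s ↔ ∀ m, s m = toAngular a b (placement M (x (M - 2)) m)) ∧
      -- it is asymptotic to the closed-form placement, and its normalization follows
      -- asymptotically the arcsine distribution
      (∀ (a b : ℕ → ℝ) (s : (M : ℕ) → Fin M → ℝ), (∀ M, a M < b M) →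
        (∀ M, 2 ≤ M → IsEquilibriumPlacement (a M) (b M) (s M)) →
        (∀ ε : ℝ, 0 < ε → ∀ᶠ M : ℕ in atTop, ∀ m : Fin M,
          |s M m - toAngular (a M) (b M) (closedFormPlacement M m)| < ε * (b M - a M)) ∧
        EmpiricalTendsto (fun M m => toNormalized (a M) (b M) (s M m)) arcsineMeasure) ∧
      -- and so does the closed-form placement
      EmpiricalTendsto closedFormPlacement arcsineMeasure := by
  choose x hanti hmem hprod using exists_eq_prod_jacobiP
  have hlc : ∀ N, (jacobiP 1 1 N).leadingCoeff ≠ 0 := fun N =>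
    Polynomial.leadingCoeff_ne_zero.2 (jacobiP_ne_zero N)
  have hroots : ∀ (N : ℕ) (z : ℂ), Polynomial.aeval z (jacobiP 1 1 N) = 0 ↔
      ∃ n : ℕ, n < N ∧ z = (x N n : ℂ) := by
    intro N z
    have hlc' : ((jacobiP 1 1 N).leadingCoeff : ℂ) ≠ 0 := by exact_mod_cast hlc N
    rw [hprod N, map_mul, map_prod, Polynomial.aeval_C, mul_eq_zero, Finset.prod_eq_zero_iff,
      Complex.coe_algebraMap, or_iff_right hlc']
    simp [sub_eq_zero]
  have hcheb : ∀ ε : ℝ, 0 < ε → ∀ᶠ N : ℕ in atTop,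
      ∀ n : ℕ, n < N → |x N n - chebyshevNode N n| < ε := by
    intro ε hε
    filter_upwards [(tendsto_const_div_atTop_nhds_zero_nat Real.pi).eventually (gt_mem_nhds hε)]
      with N hN n hn
    refine (abs_sub_chebyshevNode_le (hanti N) (hmem N) (fun i hi => ?_) hn).trans_lt hN
    rw [hprod N]
    simp only [Polynomial.IsRoot.def, Polynomial.eval_mul, Polynomial.eval_prod]
    rw [Finset.prod_eq_zero (Finset.mem_range.2 hi) (by simp), mul_zero]
  have hequil : ∀ (M : ℕ) (a b : ℝ), 2 ≤ M → a < b → ∀ s : Fin M → ℝ,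
      IsEquilibriumPlacement a b s ↔ ∀ m, s m = toAngular a b (placement M (x (M - 2)) m) := by
    intro M a b hM hab s
    obtain ⟨N, rfl⟩ := Nat.exists_eq_add_of_le' hM
    rw [isEquilibriumPlacement_iff_toNormalized hab,
      isEquilibriumPlacement_neg_one_one_iff (hanti N) (hmem N) (hprod N), funext_iff]
    exact forall_congr' fun m => toNormalized_eq_iff hab
  have hclose : ∀ ε : ℝ, 0 < ε → ∀ᶠ M : ℕ in atTop, ∀ m : Fin M,
      |placement M (x (M - 2)) m - closedFormPlacement M m| < ε := by
    intro ε hε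
    filter_upwards [(tendsto_sub_atTop_nat 2).eventually (hcheb ε hε), eventually_ge_atTop 2]
      with M h hM m
    obtain ⟨N, rfl⟩ := Nat.exists_eq_add_of_le' hM
    exact abs_placement_sub_placement_lt hε h m
  refine ⟨x, fun N => ⟨hanti N, hmem N, hroots N⟩, hcheb, hequil, fun a b s hab hs => ?_,
    empiricalTendsto_closedFormPlacement⟩
  have hseq : ∀ M, 2 ≤ M → ∀ m, s M m = toAngular (a M) (b M) (placement M (x (M - 2)) m) :=
    fun M hM => (hequil M _ _ hM (hab M) _).1 (hs M hM)
  have hnorm : ∀ M, 2 ≤ M → ∀ m,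
      toNormalized (a M) (b M) (s M m) = placement M (x (M - 2)) m :=
    fun M hM m => (toNormalized_eq_iff (hab M)).2 (hseq M hM m)
  constructor
  · intro ε hε
    filter_upwards [hclose ε hε, eventually_ge_atTop 2] with M h hM m
    have hba : 0 < b M - a M := sub_pos.2 (hab M)
    rw [hseq M hM m, toAngular, toAngular, add_sub_add_right_eq_sub, ← mul_sub, abs_mul,
      abs_of_pos (half_pos hba)]
    nlinarith [h m, abs_nonneg (placement M (x (M - 2)) m - closedFormPlacement M m)]
  · refine empiricalTendsto_closedFormPlacement.of_abs_sub_lt ?_ ?_ fun ε hε => ?_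
    · filter_upwards [eventually_ge_atTop 2] with M hM m
      rw [hnorm M hM m]
      obtain ⟨N, rfl⟩ := Nat.exists_eq_add_of_le' hM
      exact placement_mem_Icc (fun n hn => Set.Ioo_subset_Icc_self (hmem N n hn)) m
    · filter_upwards [eventually_ge_atTop 2] with M hM m
      obtain ⟨N, rfl⟩ := Nat.exists_eq_add_of_le' hM
      exact placement_mem_Icc (fun n _ => ⟨Real.neg_one_le_cos _, Real.cos_le_one _⟩) m
    · filter_upwards [hclose ε hε, eventually_ge_atTop 2] with M h hM m
      rw [hnorm M hM m]
      exact h m
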